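/- Fix cross gains $0\le a<1$, $0\le b<1$, power budgets and a weight $\breve\mu\ge 0$. Let $\mathrm{GIC}(P_1,P_2,a,b,1,1)$ be the two-user weak Gaussian interference channel $Y_1=X_1+\sqrt a\,X_2+Z_1$, $Y_2=\sqrt b\,X_1+X_2+Z_2$ with power budgets $P_1,P_2$ and unit noise powers. Write $C(P,N)=\tfrac12\log_2(1+P/N)$. A (Gaussian public/private) solution for this channel consists, for each user $k\in\{1,2\}$, of one private layer of power $V_k\ge 0$ and rate $R_{V_k}\ge 0$ and of finitely many (possibly no) public layers of powers $U_{k,i}\ge 0$ and rates $R_{U_{k,i}}\ge 0$, such that 1. $\sum_i U_{k,i}+V_k\le P_k$ for $k=1,2$; 2. all public layers are jointly decodable at both receivers with the private layers as noise, i.e. for all sets $A$ of public layers of user 1 and $B$ of public layers of user 2, $$\sum_{i\in A}R_{U_{1,i}}+\sum_{j\in B}R_{U_{2,j}}\le C\Big(\sum_{i\in A}U_{1,i}+a\sum_{j\in B}U_{2,j},\;V_1+aV_2+1\Big),$$ $$\sum_{i\in A}R_{U_{1,i}}+\sum_{j\in B}R_{U_{2,j}}\le C\Big(b\sum_{i\in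 A}U_{1,i}+\sum_{j\in B}U_{2,j},\;bV_1+V_2+1\Big);$$ 3. each private layer is decoded by its own receiver after the public layers have been removed, with the other private layer as noise: $R_{V_1}\le C(V_1,aV_2+1)$ and $R_{V_2}\le C(V_2,bV_1+1)$. Its rate pair is $R_k=\sum_i R_{U_{k,i}}+R_{V_k}$, $k=1,2$; the rate region of the channel is the set of the rate pairs of all solutions (no time sharing). A solution is optimum for the weight $\breve\mu$ if its rate pair maximizes $R_{ws}=R_1+\breve\mu R_2$ over the rate region. **Theorem (nested optimality).** Suppose that a solution is optimum for $\mathrm{GIC}(P_1,P_2,a,b,1,1)$ and the weight $\breve\mu$, so that its rate pair is a point on the boundary of the region maximizing $R_1+\breve\mu R_2$, and let $P_1^{(private)}=V_1$ and $P_2^{(private)}=V_2$ be the powers it allocates to private messages. Then, for the same weight $\breve\mu$, the channel $\mathrm{GIC}(P_1^{(private)},P_2^{(private)},a,b,1,1)$ has an optimum solution with private messages only, of powers $P_1^{(private)}$ and $P_2^{(private)}$; indeed the private layers of the given solution, with unchanged powers and rates and without any public layer, form such an optimum solution. -/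

import Mathlib

/-- Rate `½ log₂ (1 + P / N)` of a Gaussian layer of received power `P` that is decoded in the
presence of Gaussian noise (channel noise plus all signals treated as noise) of power `N`. -/
noncomputable def awgnRate (P N : ℝ) : ℝ :=
  (1 / 2) * Real.logb 2 (1 + P / N)

/-- Rate region of the Gaussian multiple access channel in which finitely many independent
Gaussian layers, of received powers `P i`, are jointly decoded in Gaussian noise of power `N`:
every group `A` of layers has total rate at most `½ log₂ (1 + (∑ i ∈ A, P i) / N)`.  For two
layers this is the region of `MAC(P₁, P₂, N)`. -/
def gaussianMAC {ι : Type} [Fintype ι] (P : ι → ℝ) (N : ℝ) : Set (ι → ℝ) :=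
  {R | (∀ i, 0 ≤ R i) ∧ ∀ A : Finset ι, ∑ i ∈ A, R i ≤ awgnRate (∑ i ∈ A, P i) N}

/-- The parameters of the two-user Gaussian interference channel
`GIC(P₁, P₂, a, b, σ₁², σ₂²)`,
`Y₁ = X₁ + √a X₂ + Z₁` and `Y₂ = √b X₁ + X₂ + Z₂`,
with power budgets `P₁`, `P₂`, cross (power) gains `a`, `b`, and noise powers
`N₁ = σ₁²`, `N₂ = σ₂²`. -/
structure GIC where
  P₁ : ℝ
  P₂ : ℝ
  a : ℝ
  b : ℝ
  N₁ : ℝ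
  N₂ : ℝ

/-- The data of a Gaussian public/private superposition scheme: the input of each user is the sum
of independent Gaussian layers, namely one private layer (power `V₁`, resp. `V₂`, rate `RV₁`,
resp. `RV₂`) and finitely many public layers (powers `U₁`, `U₂`, rates `RU₁`, `RU₂`). -/
structure Scheme where
  n₁ : ℕ
  n₂ : ℕ
  U₁ : Fin n₁ → ℝ
  U₂ : Fin n₂ → ℝ
  V₁ : ℝ
  V₂ : ℝ
  RU₁ : Fin n₁ → ℝ
  RU₂ : Fin n₂ → ℝ
  RV₁ : ℝ
  RV₂ : ℝ

namespace Scheme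

/-- The pair `(R₁, R₂)` of the users' total (public plus private) rates. -/
def rates (S : Scheme) : ℝ × ℝ :=
  (∑ i, S.RU₁ i + S.RV₁, ∑ j, S.RU₂ j + S.RV₂)

/-- The private layers of a scheme on their own: there is no public layer, and the private powers
and rates are unchanged. -/
def privatePart (S : Scheme) : Scheme where
  n₁ := 0
  n₂ := 0
  U₁ := fun _ => 0
  U₂ := fun _ => 0
  V₁ := S.V₁
  V₂ := S.V₂
  RU₁ := fun _ => 0
  RU₂ := fun _ => 0
  RV₁ := S.RV₁
  RV₂ := S.RV₂

end Scheme

namespace GIC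

/-- A scheme is admissible for the channel if its powers are nonnegative and respect the budgets;
all public layers of both users are (jointly) decoded at both receivers, with both private layers
as noise; and each private layer is decoded at its own receiver only, after removal of the public
layers, with the private layer of the other user as noise. -/
structure Admissible (G : GIC) (S : Scheme) : Prop where
  U₁_nonneg : ∀ i, 0 ≤ S.U₁ i
  U₂_nonneg : ∀ j, 0 ≤ S.U₂ j
  V₁_nonneg : 0 ≤ S.V₁
  V₂_nonneg : 0 ≤ S.V₂
  power₁ : ∑ i, S.U₁ i + S.V₁ ≤ G.P₁
  power₂ : ∑ j, S.U₂ j + S.V₂ ≤ G.P₂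
  public₁ : Sum.elim S.RU₁ S.RU₂ ∈
    gaussianMAC (Sum.elim S.U₁ (fun j => G.a * S.U₂ j)) (S.V₁ + G.a * S.V₂ + G.N₁)
  public₂ : Sum.elim S.RU₁ S.RU₂ ∈
    gaussianMAC (Sum.elim (fun i => G.b * S.U₁ i) S.U₂) (G.b * S.V₁ + S.V₂ + G.N₂)
  RV₁_nonneg : 0 ≤ S.RV₁
  RV₂_nonneg : 0 ≤ S.RV₂
  private₁ : S.RV₁ ≤ awgnRate S.V₁ (G.a * S.V₂ + G.N₁)
  private₂ : S.RV₂ ≤ awgnRate S.V₂ (G.b * S.V₁ + G.N₂)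

/-- The (constituent) rate region of the channel: the pairs `(R₁, R₂)` of all admissible schemes,
without time sharing. -/
def rateRegion (G : GIC) : Set (ℝ × ℝ) :=
  {R | ∃ S : Scheme, G.Admissible S ∧ S.rates = R}

/-- The scheme is an optimum solution for the weight `μ`: it is admissible and its rate pair
maximizes `R₁ + μ R₂` over the rate region (so that it lies on the boundary of the region). -/
def IsOptimal (G : GIC) (μ : ℝ) (S : Scheme) : Prop :=
  G.Admissible S ∧ IsMaxOn (fun R : ℝ × ℝ => R.1 + μ * R.2) G.rateRegion S.rates

end GIC

/-! The argument is an exchange. If some scheme `T` on the private budgets beat the private layers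
of `S`, put all of `T` in their place and keep the public layers of `S`. The result, `S.nest T`, is
admissible for the original channel (`Admissible.nest`). The public rates of `S` contribute equally
to both weighted sums, so `S.nest T` would beat `S`. Admissibility rests on `awgnRate_add_le`:
decoding the public layers of `S` first, then those of `T`, is covered by joint decoding. -/

/-- Successive decoding is a special case of joint decoding: if the layers `P` are decoded in noise
of power `N`, and `N` exceeds `N'` by at least the power of further layers `Q` that are decoded in
noise of power `N'`, the sum of the two rates is achieved by decoding both in noise `N'`. -/
lemma awgnRate_add_le {P Q N N' : ℝ} (hP : 0 ≤ P) (hQ : 0 ≤ Q) (hN' : 0 < N')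
    (hN : N' + Q ≤ N) : awgnRate P N + awgnRate Q N' ≤ awgnRate (P + Q) N' := by
  have hN0 : 0 < N := by linarith
  have hmul : (1 + P / N) * (1 + Q / N') ≤ 1 + (P + Q) / N' := by
    -- When `N = N' + Q` the factor `(N' + Q) / N` is 1 and the product telescopes exactly; a larger
    -- `N` only shrinks it.
    have hcalc : (1 + P / N) * (1 + Q / N') = (1 + Q / N') + P * ((N' + Q) / N) / N' := by
      field_simp
    have hfrac : P * ((N' + Q) / N) ≤ P :=
      mul_le_of_le_one_right hP ((div_le_one hN0).2 hN)
    have hdiv := div_le_div_of_nonneg_right hfrac hN'.le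
    rw [hcalc, add_div P Q]
    linarith
  have h₁ : 0 < 1 + P / N := by positivity
  have h₂ : 0 < 1 + Q / N' := by positivity
  unfold awgnRate
  rw [← mul_add, ← Real.logb_mul h₁.ne' h₂.ne']
  gcongr
  norm_num

lemma awgnRate_zero (N : ℝ) : awgnRate 0 N = 0 := by
  simp [awgnRate]

lemma gaussianMAC_of_isEmpty {ι : Type} [Fintype ι] [IsEmpty ι] (P R : ι → ℝ) (N : ℝ) :
    R ∈ gaussianMAC P N :=
  ⟨isEmptyElim, fun A => by simp [A.eq_empty_of_isEmpty, awgnRate_zero]⟩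

/-- A group of layers splits into its `P`-part and its `Q`-part. The noise `N` allows for all of
`Q`, hence for any subset of it, so the two-rate inequality applies to each group. -/
lemma gaussianMAC_sumElim {ι κ : Type} [Fintype ι] [Fintype κ] {P R : ι → ℝ} {Q T : κ → ℝ}
    {N N' : ℝ} (hR : R ∈ gaussianMAC P N) (hT : T ∈ gaussianMAC Q N')
    (hP : ∀ i, 0 ≤ P i) (hQ : ∀ k, 0 ≤ Q k) (hN' : 0 < N') (hN : N' + ∑ k, Q k ≤ N) :
    Sum.elim R T ∈ gaussianMAC (Sum.elim P Q) N' := by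
  refine ⟨Sum.rec hR.1 hT.1, fun A => ?_⟩
  have hle : ∑ k ∈ A.toRight, Q k ≤ ∑ k, Q k :=
    Finset.sum_le_univ_sum_of_nonneg hQ
  rw [← Finset.toLeft_disjSum_toRight (u := A)]
  simp only [Finset.sum_disjSum, Sum.elim_inl, Sum.elim_inr]
  exact (add_le_add (hR.2 _) (hT.2 _)).trans
    (awgnRate_add_le (Finset.sum_nonneg fun i _ => hP i) (Finset.sum_nonneg fun k _ => hQ k)
      hN' (by linarith))

lemma gaussianMAC_comp_equiv {ι κ : Type} [Fintype ι] [Fintype κ] (e : κ ≃ ι) {P R : ι → ℝ}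
    {N : ℝ} (hR : R ∈ gaussianMAC P N) : R ∘ e ∈ gaussianMAC (P ∘ e) N := by
  refine ⟨fun k => hR.1 (e k), fun A => ?_⟩
  simpa using hR.2 (A.map e.toEmbedding)

/-- The interleaving of the layer indices of two users in two schemes. -/
def layerEquiv (m n k l : ℕ) :
    Fin (m + n) ⊕ Fin (k + l) ≃ (Fin m ⊕ Fin k) ⊕ (Fin n ⊕ Fin l) :=
  (Equiv.sumCongr finSumFinEquiv.symm finSumFinEquiv.symm).trans (Equiv.sumSumSumComm _ _ _ _)

lemma sumElim_comp_layerEquiv {m n k l : ℕ} (f : Fin m → ℝ) (g : Fin n → ℝ) (f' : Fin k → ℝ)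
    (g' : Fin l → ℝ) :
    Sum.elim (Sum.elim f f') (Sum.elim g g') ∘ layerEquiv m n k l =
      Sum.elim (Fin.append f g) (Fin.append f' g') := by
  funext x
  rcases x with i | j
  · refine Fin.addCases (fun i => ?_) (fun i => ?_) i <;> simp [layerEquiv]
  · refine Fin.addCases (fun i => ?_) (fun i => ?_) j <;> simp [layerEquiv]

lemma Fin.append_nonneg {m n : ℕ} {f : Fin m → ℝ} {g : Fin n → ℝ} (hf : ∀ i, 0 ≤ f i)
    (hg : ∀ i, 0 ≤ g i) (i : Fin (m + n)) : 0 ≤ Fin.append f g i := by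
  refine Fin.addCases (fun i => ?_) (fun i => ?_) i <;> simp [hf, hg]

lemma Fin.const_mul_append {m n : ℕ} (c : ℝ) (f : Fin m → ℝ) (g : Fin n → ℝ) :
    (fun i => c * Fin.append f g i) = Fin.append (fun i => c * f i) (fun i => c * g i) := by
  funext i
  refine Fin.addCases (fun i => ?_) (fun i => ?_) i <;> simp

lemma Fin.sum_append {m n : ℕ} (f : Fin m → ℝ) (g : Fin n → ℝ) :
    ∑ i, Fin.append f g i = ∑ i, f i + ∑ i, g i := by
  simp [Fin.sum_univ_add]

namespace Scheme

/-- The scheme in which the private layers of `S` are replaced by all layers of `T`. -/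
def nest (S T : Scheme) : Scheme where
  n₁ := S.n₁ + T.n₁
  n₂ := S.n₂ + T.n₂
  U₁ := Fin.append S.U₁ T.U₁
  U₂ := Fin.append S.U₂ T.U₂
  V₁ := T.V₁
  V₂ := T.V₂
  RU₁ := Fin.append S.RU₁ T.RU₁
  RU₂ := Fin.append S.RU₂ T.RU₂
  RV₁ := T.RV₁
  RV₂ := T.RV₂

lemma rates_nest (S T : Scheme) :
    (S.nest T).rates = (∑ i, S.RU₁ i + T.rates.1, ∑ j, S.RU₂ j + T.rates.2) := by
  have h₁ := Fin.sum_append S.RU₁ T.RU₁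
  have h₂ := Fin.sum_append S.RU₂ T.RU₂
  refine Prod.ext ?_ ?_
  · exact (congrArg (· + T.RV₁) h₁).trans (add_assoc _ _ _)
  · exact (congrArg (· + T.RV₂) h₂).trans (add_assoc _ _ _)

lemma rates_privatePart (S : Scheme) : S.privatePart.rates = (S.RV₁, S.RV₂) := by
  simp [rates, privatePart]

end Scheme

namespace GIC

lemma Admissible.privatePart {G : GIC} {S : Scheme} (hS : G.Admissible S) :
    ({ G with P₁ := S.V₁, P₂ := S.V₂ } : GIC).Admissible S.privatePart where
  U₁_nonneg _ := le_rfl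
  U₂_nonneg _ := le_rfl
  V₁_nonneg := hS.V₁_nonneg
  V₂_nonneg := hS.V₂_nonneg
  power₁ := by simp [Scheme.privatePart]
  power₂ := by simp [Scheme.privatePart]
  public₁ :=
    have : IsEmpty (Fin S.privatePart.n₁ ⊕ Fin S.privatePart.n₂) :=
      inferInstanceAs (IsEmpty (Fin 0 ⊕ Fin 0))
    gaussianMAC_of_isEmpty _ _ _
  public₂ :=
    have : IsEmpty (Fin S.privatePart.n₁ ⊕ Fin S.privatePart.n₂) :=
      inferInstanceAs (IsEmpty (Fin 0 ⊕ Fin 0))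
    gaussianMAC_of_isEmpty _ _ _
  RV₁_nonneg := hS.RV₁_nonneg
  RV₂_nonneg := hS.RV₂_nonneg
  private₁ := hS.private₁
  private₂ := hS.private₂

lemma Admissible.nest {G : GIC} {S T : Scheme} (ha : 0 ≤ G.a) (hb : 0 ≤ G.b) (hN₁ : 0 < G.N₁)
    (hN₂ : 0 < G.N₂) (hS : G.Admissible S)
    (hT : ({ G with P₁ := S.V₁, P₂ := S.V₂ } : GIC).Admissible T) :
    G.Admissible (S.nest T) where
  U₁_nonneg := Fin.append_nonneg hS.U₁_nonneg hT.U₁_nonneg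
  U₂_nonneg := Fin.append_nonneg hS.U₂_nonneg hT.U₂_nonneg
  V₁_nonneg := hT.V₁_nonneg
  V₂_nonneg := hT.V₂_nonneg
  power₁ := by
    have h₁ := hS.power₁
    have h₂ : _ ≤ S.V₁ := hT.power₁
    have h₃ := Fin.sum_append S.U₁ T.U₁
    refine (congrArg (· + T.V₁) h₃).trans_le ?_
    linarith
  power₂ := by
    have h₁ := hS.power₂
    have h₂ : _ ≤ S.V₂ := hT.power₂
    have h₃ := Fin.sum_append S.U₂ T.U₂
    refine (congrArg (· + T.V₂) h₃).trans_le ?_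
    linarith
  public₁ := by
    have hV₁ := hT.V₁_nonneg
    have hV₂ := mul_nonneg ha hT.V₂_nonneg
    -- The whole received power of `T` fits within the private power that the public layers of `S`
    -- already tolerate as noise.
    have h₁ : _ ≤ S.V₁ := hT.power₁
    have h₂ : _ ≤ G.a * S.V₂ := mul_le_mul_of_nonneg_left hT.power₂ ha
    have h := gaussianMAC_sumElim hS.public₁ hT.public₁
      (Sum.rec hS.U₁_nonneg fun j => mul_nonneg ha (hS.U₂_nonneg j))
      (Sum.rec hT.U₁_nonneg fun j => mul_nonneg ha (hT.U₂_nonneg j))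
      (by simp only; linarith)
      (by
        simp only [Fintype.sum_sum_type, Sum.elim_inl, Sum.elim_inr, ← Finset.mul_sum]
        linarith)
    -- The layers in `h` are grouped by scheme; admissibility wants them grouped by user.
    have h' := gaussianMAC_comp_equiv (layerEquiv S.n₁ T.n₁ S.n₂ T.n₂) h
    rw [sumElim_comp_layerEquiv, sumElim_comp_layerEquiv, ← Fin.const_mul_append] at h'
    exact h'
  public₂ := by
    have hV₁ := mul_nonneg hb hT.V₁_nonneg
    have hV₂ := hT.V₂_nonneg
    have h₁ : _ ≤ G.b * S.V₁ := mul_le_mul_of_nonneg_left hT.power₁ hb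
    have h₂ : _ ≤ S.V₂ := hT.power₂
    have h := gaussianMAC_sumElim hS.public₂ hT.public₂
      (Sum.rec (fun i => mul_nonneg hb (hS.U₁_nonneg i)) hS.U₂_nonneg)
      (Sum.rec (fun i => mul_nonneg hb (hT.U₁_nonneg i)) hT.U₂_nonneg)
      (by simp only; linarith)
      (by
        simp only [Fintype.sum_sum_type, Sum.elim_inl, Sum.elim_inr, ← Finset.mul_sum]
        linarith)
    have h' := gaussianMAC_comp_equiv (layerEquiv S.n₁ T.n₁ S.n₂ T.n₂) h
    rw [sumElim_comp_layerEquiv, sumElim_comp_layerEquiv, ← Fin.const_mul_append] at h'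
    exact h'
  RV₁_nonneg := hT.RV₁_nonneg
  RV₂_nonneg := hT.RV₂_nonneg
  private₁ := hT.private₁
  private₂ := hT.private₂

end GIC

theorem theorem2 (P₁ P₂ a b μ : ℝ) (ha₀ : 0 ≤ a) (ha : a < 1) (hb₀ : 0 ≤ b) (hb : b < 1)
    (hμ : 0 ≤ μ) (S : Scheme) (hS : (GIC.mk P₁ P₂ a b 1 1).IsOptimal μ S) :
    (GIC.mk S.V₁ S.V₂ a b 1 1).IsOptimal μ S.privatePart := by
  refine ⟨hS.1.privatePart, ?_⟩
  rintro _ ⟨T, hT, rfl⟩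
  have hmax := hS.2 ⟨S.nest T, hS.1.nest ha₀ hb₀ one_pos one_pos hT, rfl⟩
  simp only [Set.mem_ofPred_eq, Scheme.rates_nest] at hmax
  simp only [Set.mem_ofPred_eq, Scheme.rates_privatePart]
  simp only [Scheme.rates] at hmax ⊢
  linarith
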